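/- Let $\alpha\in\mathbb{C}$ with $0<\operatorname{Re}\alpha<1$, let $A$ be a complex $n\times n$ matrix and $I$ the $n\times n$ identity matrix. For a sequence $x:\{0,1,2,\dots\}\to\mathbb{C}^n$ put $(\Delta x)(s)=x(s+1)-x(s)$; for $\operatorname{Re}\beta>0$ let $$(\Delta^{-\beta}x)(\beta+m)=\frac{1}{\Gamma(\beta)}\sum_{s=0}^{m}\frac{\Gamma(\beta+m-s)}{\Gamma(m-s+1)}\,x(s),\qquad m=0,1,2,\dots,$$ and let $\Delta^{\alpha}x=\Delta^{-(1-\alpha)}(\Delta x)$ be the Caputo-like fractional difference, a function on $\{1-\alpha,2-\alpha,\dots\}$. Let $\tilde\phi_\alpha(m)=\binom{m+\alpha-1}{m}$, the generalized binomial coefficient, and $(\tilde\phi_\alpha*x)(m)=\sum_{s=0}^{m}\tilde\phi_\alpha(m-s)x(s)$. Consider the system $$(\Delta^{\alpha}x)(t)=(A-I)\,x(t+\alpha-1),\qquad t\in\{1-\alpha,2-\alpha,3-\alpha,\dots\},\quad x(0)=x_0,\tag{a}$$ and the recursion $$x(t+1)=x_0+(A-I)(\tilde\phi_\alpha*x)(t),\qquad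 t=0,1,2,\dots,\quad x(0)=x_0.\tag{b}$$ The zero solution of such a system is called asymptotically stable if for every $\epsilon>0$ there is $\delta>0$ such that $\|x_0\|<\delta$ implies $\|x(t)\|<\epsilon$ for all $t=1,2,\dots$, and if moreover there is $\delta>0$ such that $\|x_0\|<\delta$ implies $x(t)\to0$ as $t\to\infty$. Then (a) and (b) have the same solutions, and the zero solution of (a), and likewise that of (b), is asymptotically stable if and only if all the roots $z\in\mathbb{C}\setminus\{0\}$ of $$\det\bigl(z(1-z^{-1})^{\alpha}I-(A-I)\bigr)=0$$ satisfy $|z|<1$, where the power is the principal one and $0^\alpha=0$. -/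

import Mathlib

open Filter Topology

noncomputable section

namespace ComplexOrder

/-- The sequence `φ̃_α(n) = binom(n + α - 1, n)`, with the generalized binomial coefficient
`binom(μ, n) = μ (μ - 1) ⋯ (μ - n + 1) / n!`. -/
def phi (α : ℂ) (n : ℕ) : ℂ :=
  Ring.choose ((n : ℂ) + α - 1) n

/-- The convolution `(a * x)(n) = ∑_{s = 0}^{n} a(n - s) x(s)` of a scalar sequence with a sequence
of vectors. -/
def conv {d : ℕ} (a : ℕ → ℂ) (x : ℕ → Fin d → ℂ) (n : ℕ) : Fin d → ℂ :=
  ∑ s ∈ Finset.range (n + 1), a (n - s) • x s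

/-- The fractional sum `Δ^{-β} x` of complex order `β` (with `Re β > 0`) of a sequence `x` on
`{0, 1, 2, …}`. It is a function on the shifted lattice `{β, β + 1, β + 2, …}`; `fracSum β x n` is
its value at the point `t = β + n`:
`(Δ^{-β} x)(β + n) = (1 / Γ(β)) ∑_{s = 0}^{n} Γ(β + n - s) / Γ(n - s + 1) x(s)`. -/
def fracSum {d : ℕ} (β : ℂ) (x : ℕ → Fin d → ℂ) (n : ℕ) : Fin d → ℂ :=
  (Complex.Gamma β)⁻¹ • ∑ s ∈ Finset.range (n + 1),
    (Complex.Gamma (β + (n : ℂ) - (s : ℂ)) / Complex.Gamma ((n : ℂ) - (s : ℂ) + 1)) • x s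

/-- The Caputo-like fractional difference `Δ^α x = Δ^{-(1 - α)} (Δ x)` of complex order `α` (with
`0 < Re α < 1`), where `(Δ x)(s) = x(s + 1) - x(s)`. It is a function on the lattice
`{1 - α, 2 - α, 3 - α, …}`; `caputoDiff α x n` is its value at the point `t = 1 - α + n`. -/
def caputoDiff {d : ℕ} (α : ℂ) (x : ℕ → Fin d → ℂ) (n : ℕ) : Fin d → ℂ :=
  fracSum (1 - α) (fwdDiff 1 x) n

/-- `x` solves `(Δ^α x)(t) = (A - I) x(t + α - 1)` for all `t = 1 - α + n`, `n = 0, 1, 2, …`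
(for such `t` one has `t + α - 1 = n`). -/
def IsCaputoSolution {d : ℕ} (α : ℂ) (A : Matrix (Fin d) (Fin d) ℂ) (x : ℕ → Fin d → ℂ) : Prop :=
  ∀ n : ℕ, caputoDiff α x n = (A - 1).mulVec (x n)

/-- `x` solves `x(t + 1) = x(0) + (A - I) (φ̃_α * x)(t)` for all `t = 0, 1, 2, …`. -/
def IsConvSolution {d : ℕ} (α : ℂ) (A : Matrix (Fin d) (Fin d) ℂ) (x : ℕ → Fin d → ℂ) : Prop :=
  ∀ t : ℕ, x (t + 1) = x 0 + (A - 1).mulVec (conv (phi α) x t)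

/-- Stability of the equilibrium `p` of a system whose solutions are the sequences satisfying
`Sol`. -/
def IsStable {d : ℕ} (Sol : (ℕ → Fin d → ℂ) → Prop) (p : Fin d → ℂ) : Prop :=
  ∀ ε > 0, ∃ δ > 0, ∀ x : ℕ → Fin d → ℂ, Sol x → ‖x 0 - p‖ < δ → ∀ t : ℕ, 1 ≤ t → ‖x t - p‖ < ε

/-- Asymptotic stability of the equilibrium `p` of a system whose solutions are the sequences
satisfying `Sol`: it is stable and attracts the solutions that start near it. -/
def IsAsymptoticallyStable {d : ℕ} (Sol : (ℕ → Fin d → ℂ) → Prop) (p : Fin d → ℂ) : Prop :=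
  IsStable Sol p ∧
    ∃ δ > 0, ∀ x : ℕ → Fin d → ℂ, Sol x → ‖x 0 - p‖ < δ → Tendsto x atTop (𝓝 p)

/-- All roots of `det (z (1 - z⁻¹)^α I - (A - I)) = 0` satisfy `|z| < 1`. The power is the
principal one; for `|z| ≥ 1` its base has nonnegative real part, and at `z = 1` it is
`0 ^ α = 0`. -/
def AllRootsInUnitDisc {d : ℕ} (α : ℂ) (A : Matrix (Fin d) (Fin d) ℂ) : Prop :=
  ∀ z : ℂ, z ≠ 0 →
    ((z * (1 - z⁻¹) ^ α) • (1 : Matrix (Fin d) (Fin d) ℂ) - (A - 1)).det = 0 → ‖z‖ < 1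

end ComplexOrder

end

/-!
A solution is studied through the generating functions of its coordinates. The sequence `phi β` has
generating function `(1 - X) ^ (-β)`, and these series multiply by adding exponents. The Caputo
equation and the convolution recursion then differ by the unit factor `(1 - X) ^ (-α)`, hence have
the same solutions. The generating vector `G` of a solution satisfies `Q (1 - X) G = (1 - X) ^ α x(0)`
with `Q(w) = (1 - w) ^ α - w (A - 1)` (`IsConvSolution.genSeries_eq`), and for `w = z⁻¹` the condition
on the roots `z` says that `det Q` has no zero in the closed unit disc.

Suppose there are no such zeros. The coefficients of `(1 - w) ^ α` are absolutely summable because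
`0 < re α`, so `det Q` lies in the Banach algebra `ℓ¹(ℕ)`, whose characters are the evaluations at
points of the closed disc. By Gelfand theory (`wienerAlgebra.isUnit_of_eval_ne_zero`) `det Q` is
invertible there, and `(1 - X) G = Q⁻¹ (1 - X) ^ α x(0)` has absolutely summable coefficients. The
solution is the sequence of their partial sums: it is bounded by a multiple of `‖x(0)‖`, and converges
to the value at `w = 1`, which is zero.

Conversely, let `w = z⁻¹` be a zero of `det Q` in the closed disc. Pairing solutions with a left
eigenvector gives scalar sequences with generating function `F` such that
`((1 - s) ^ α - c s) F(s) = (1 - s) ^ (α - 1) a`, where `a` is the initial value and the first factor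
vanishes at `s = w`. If the sequence tends to zero then `F(r w) = o(1 / (1 - r))` as `r → 1⁻` by Abel's
limit theorem (`tendsto_one_sub_mul_tsum`), so the left-hand side tends to zero along `s = r w`, and
`a = 0` when `w ≠ 1`; for `w = 1` the sequence is constant. So some solutions starting arbitrarily
close to zero do not converge to zero.
-/

namespace ComplexOrder

open PowerSeries

/-! ### Generating functions -/

theorem phi_eq (β : ℂ) (n : ℕ) : phi β n = (-1) ^ n * Ring.choose (-β) n := by
  rw [Ring.choose_neg, phi, add_comm (n : ℂ) β, Units.smul_def, zsmul_eq_mul, ← mul_assoc]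
  simp [← mul_pow]

@[simp]
theorem phi_zero (β : ℂ) : phi β 0 = 1 := by simp [phi]

theorem phi_succ (β : ℂ) (n : ℕ) : (n + 1 : ℂ) * phi β (n + 1) = (β + n) * phi β n := by
  simp only [phi_eq, Ring.choose_eq_smul, Nat.factorial_succ, smul_eq_mul,
    descPochhammer_succ_right, Polynomial.smeval_mul, Polynomial.smeval_sub, Polynomial.smeval_X,
    Polynomial.smeval_natCast]
  have h1 : (n.factorial : ℂ) ≠ 0 := by exact_mod_cast n.factorial_ne_zero
  have h2 : (n + 1 : ℂ) ≠ 0 := by exact_mod_cast n.succ_ne_zero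
  push_cast
  field_simp
  simp
  ring

theorem Gamma_div_Gamma_eq_phi {β : ℂ} (hβ : 0 < β.re) (n : ℕ) :
    (Complex.Gamma β)⁻¹ * (Complex.Gamma (β + n) / Complex.Gamma (n + 1)) = phi β n := by
  induction n with
  | zero => simp [Complex.Gamma_ne_zero_of_re_pos hβ]
  | succ n ih =>
    have h2 : (n + 1 : ℂ) ≠ 0 := by exact_mod_cast n.succ_ne_zero
    have h3 : β + n ≠ 0 := fun h => by
      have := congrArg Complex.re h
      simp at this
      linarith [n.cast_nonneg (α := ℝ)]
    have h4 : Complex.Gamma (n + 1) ≠ 0 := Complex.Gamma_ne_zero_of_re_pos (by simp; positivity)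
    apply mul_left_cancel₀ h2
    rw [phi_succ, ← ih]
    push_cast
    rw [← add_assoc, Complex.Gamma_add_one _ h3, Complex.Gamma_add_one _ h2]
    field_simp

/-- The formal power series of `(1 - X) ^ (-β)`, whose coefficients are `phi β`. -/
noncomputable def phiSeries (β : ℂ) : ℂ⟦X⟧ := PowerSeries.mk (phi β)

@[simp]
theorem coeff_phiSeries (β : ℂ) (n : ℕ) : coeff n (phiSeries β) = phi β n := coeff_mk _ _

theorem phiSeries_add (β γ : ℂ) : phiSeries (β + γ) = phiSeries β * phiSeries γ := by
  have h (δ : ℂ) : phiSeries δ = rescale (-1 : ℂ) (binomialSeries ℂ (-δ)) := by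
    ext n
    simp [coeff_rescale, phi_eq]
  rw [h, h, h, ← map_mul, ← binomialSeries_add, neg_add]

@[simp]
theorem phiSeries_zero : phiSeries 0 = 1 := by
  ext n
  cases n with
  | zero => simp
  | succ n => simp [phi_eq, coeff_one, Ring.choose_zero_succ]

theorem phiSeries_mul_neg (β : ℂ) : phiSeries β * phiSeries (-β) = 1 := by
  rw [← phiSeries_add, add_neg_cancel, phiSeries_zero]

theorem phi_one (n : ℕ) : phi 1 n = 1 := by
  simp [phi, Ring.choose_natCast]

theorem phiSeries_neg_one : phiSeries (-1) = 1 - X := by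
  have h : phiSeries 1 * (1 - X) = 1 := by
    have : phiSeries 1 = PowerSeries.mk 1 := by
      ext n
      simp [phi_one]
    rw [this]
    exact mk_one_mul_one_sub_eq_one ℂ
  calc phiSeries (-1) = phiSeries (-1) * (phiSeries 1 * (1 - X)) := by rw [h, mul_one]
    _ = phiSeries 1 * phiSeries (-1) * (1 - X) := by ring
    _ = 1 - X := by rw [phiSeries_mul_neg, one_mul]

theorem phiSeries_mul_left_inj {β : ℂ} {f g : ℂ⟦X⟧} :
    phiSeries β * f = phiSeries β * g ↔ f = g := by
  refine ⟨fun h => ?_, fun h => h ▸ rfl⟩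
  have := congrArg (phiSeries (-β) * ·) h
  simpa only [← mul_assoc, mul_comm (phiSeries (-β)) (phiSeries β), phiSeries_mul_neg, one_mul]
    using this

/-- Multiplication by `phiSeries 1 = 1 / (1 - X)` replaces the coefficients by their partial
sums. -/
theorem coeff_phiSeries_one_mul (f : ℂ⟦X⟧) (n : ℕ) :
    coeff n (phiSeries 1 * f) = ∑ k ∈ Finset.range (n + 1), coeff k f := by
  rw [mul_comm, coeff_mul, Finset.Nat.sum_antidiagonal_eq_sum_range_succ_mk]
  simp [phi_one]

variable {d : ℕ}

/-- The generating function of the `i`-th coordinate of a sequence of vectors. -/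
noncomputable def genSeries (x : ℕ → Fin d → ℂ) (i : Fin d) : ℂ⟦X⟧ := PowerSeries.mk fun n => x n i

@[simp]
theorem coeff_genSeries (x : ℕ → Fin d → ℂ) (i : Fin d) (n : ℕ) :
    coeff n (genSeries x i) = x n i := coeff_mk _ _

theorem conv_phi_apply (β : ℂ) (x : ℕ → Fin d → ℂ) (n : ℕ) (i : Fin d) :
    conv (phi β) x n i = coeff n (phiSeries β * genSeries x i) := by
  rw [mul_comm, coeff_mul, Finset.Nat.sum_antidiagonal_eq_sum_range_succ_mk]
  simp [conv, mul_comm]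

theorem fracSum_eq_conv {β : ℂ} (hβ : 0 < β.re) (x : ℕ → Fin d → ℂ) (n : ℕ) :
    fracSum β x n = conv (phi β) x n := by
  rw [fracSum, conv, Finset.smul_sum]
  refine Finset.sum_congr rfl fun s hs => ?_
  have hs : s ≤ n := Nat.lt_succ_iff.1 (Finset.mem_range.1 hs)
  rw [smul_smul, ← Gamma_div_Gamma_eq_phi hβ, Nat.cast_sub hs, add_sub_assoc]

theorem mulVec_conv_phi_apply (β : ℂ) (B : Matrix (Fin d) (Fin d) ℂ) (x : ℕ → Fin d → ℂ) (n : ℕ)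
    (i : Fin d) :
    B.mulVec (conv (phi β) x n) i =
      coeff n (phiSeries β * ∑ j, C (B i j) * genSeries x j) := by
  simp only [Matrix.mulVec, dotProduct, conv_phi_apply, Finset.mul_sum, map_sum]
  refine Finset.sum_congr rfl fun j _ => ?_
  rw [mul_left_comm, coeff_C_mul]

theorem isCaputoSolution_iff_genSeries {α : ℂ} (hα : α.re < 1) (A : Matrix (Fin d) (Fin d) ℂ)
    (x : ℕ → Fin d → ℂ) :
    IsCaputoSolution α A x ↔ ∀ i, phiSeries (1 - α) * genSeries (fwdDiff 1 x) i =
      ∑ j, C ((A - 1) i j) * genSeries x j := by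
  have h (n : ℕ) (i : Fin d) : (A - 1).mulVec (x n) i =
      coeff n (∑ j, C ((A - 1) i j) * genSeries x j) := by
    simp only [Matrix.mulVec, dotProduct, map_sum, coeff_C_mul, coeff_genSeries]
  simp only [IsCaputoSolution, caputoDiff, funext_iff, PowerSeries.ext_iff, h, conv_phi_apply,
    fracSum_eq_conv (β := 1 - α) (by simpa using hα)]
  exact forall_comm

theorem isConvSolution_iff_genSeries (α : ℂ) (A : Matrix (Fin d) (Fin d) ℂ) (x : ℕ → Fin d → ℂ) :
    IsConvSolution α A x ↔ ∀ i, phiSeries 1 * genSeries (fwdDiff 1 x) i =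
      phiSeries α * ∑ j, C ((A - 1) i j) * genSeries x j := by
  have h (n : ℕ) (i : Fin d) : coeff n (phiSeries 1 * genSeries (fwdDiff 1 x) i) =
      x (n + 1) i - x 0 i := by
    -- The partial sums of `fwdDiff 1 x` telescope.
    rw [coeff_phiSeries_one_mul]
    simp [fwdDiff, Finset.sum_range_sub (fun k => x k i)]
  simp only [IsConvSolution, funext_iff, PowerSeries.ext_iff, h,
    mulVec_conv_phi_apply, ← sub_eq_iff_eq_add']
  exact forall_comm

/-- In terms of generating functions, the convolution recursion is the Caputo equation multiplied by
the invertible series `(1 - X) ^ (-α)`. -/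
theorem isCaputoSolution_iff_isConvSolution {α : ℂ} (hα : α.re < 1)
    (A : Matrix (Fin d) (Fin d) ℂ) (x : ℕ → Fin d → ℂ) :
    IsCaputoSolution α A x ↔ IsConvSolution α A x := by
  rw [isCaputoSolution_iff_genSeries hα, isConvSolution_iff_genSeries]
  refine forall_congr' fun i => ?_
  rw [← phiSeries_mul_left_inj (β := α), ← mul_assoc, ← phiSeries_add, add_sub_cancel]

/-- The generating functions `G` of a solution satisfy
`((1 - X) ^ α - X (A - 1)) (1 - X) G = (1 - X) ^ α x(0)`. -/
theorem IsConvSolution.genSeries_eq {α : ℂ} {A : Matrix (Fin d) (Fin d) ℂ} {x : ℕ → Fin d → ℂ}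
    (hx : IsConvSolution α A x) (i : Fin d) :
    phiSeries (-α) * (phiSeries (-1) * genSeries x i) -
      X * ∑ j, C ((A - 1) i j) * (phiSeries (-1) * genSeries x j) =
      phiSeries (-α) * C (x 0 i) := by
  have hD : X * genSeries (fwdDiff 1 x) i = phiSeries (-1) * genSeries x i - C (x 0 i) := by
    rw [phiSeries_neg_one]
    ext n
    cases n with
    | zero => simp [genSeries]
    | succ n => simp [fwdDiff, sub_mul, coeff_succ_X_mul]
  have h := (isConvSolution_iff_genSeries α A x).1 hx i
  have e : ∑ j, C ((A - 1) i j) * (phiSeries (-1) * genSeries x j) =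
      phiSeries (-1) * ∑ j, C ((A - 1) i j) * genSeries x j := by
    rw [Finset.mul_sum]
    exact Finset.sum_congr rfl fun j _ => mul_left_comm _ _ _
  have h1 := phiSeries_mul_neg α
  have h2 := phiSeries_mul_neg 1
  rw [e]
  -- Multiply the recursion by `X (1 - X) (1 - X) ^ α` and substitute `hD` for `X` times the generating
  -- function of the differences.
  linear_combination (-phiSeries (-α)) * hD + X * phiSeries (-α) * phiSeries (-1) * h +
    X * phiSeries (-1) * (∑ j, C ((A - 1) i j) * genSeries x j) * h1 -
    X * phiSeries (-α) * genSeries (fwdDiff 1 x) i * h2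

/-! ### The Banach algebra of absolutely convergent power series -/

theorem tsum_coeff_mul {f g : ℂ⟦X⟧} {w : ℂ} (hf : Summable fun n => ‖coeff n f * w ^ n‖)
    (hg : Summable fun n => ‖coeff n g * w ^ n‖) :
    ∑' n, coeff n (f * g) * w ^ n = (∑' n, coeff n f * w ^ n) * ∑' n, coeff n g * w ^ n := by
  rw [tsum_mul_tsum_eq_tsum_sum_antidiagonal_of_summable_norm hf hg]
  refine tsum_congr fun n => ?_
  rw [coeff_mul, Finset.sum_mul]
  refine Finset.sum_congr rfl fun p hp => ?_
  rw [← Finset.HasAntidiagonal.mem_antidiagonal.1 hp]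
  ring

/-- The algebra of the formal power series with absolutely summable coefficients. Under the norm
`∑ n, ‖coeff n f‖` it is the Banach algebra `ℓ¹(ℕ)` with convolution as product. -/
noncomputable def wienerAlgebra : Subalgebra ℂ ℂ⟦X⟧ where
  carrier := {f | Summable fun n => ‖coeff n f‖}
  mul_mem' {f g} hf hg := by
    simpa only [Set.mem_ofPred_eq, coeff_mul] using
      summable_norm_sum_mul_antidiagonal_of_summable_norm hf hg
  add_mem' {f g} hf hg := by
    refine Summable.of_nonneg_of_le (fun _ => norm_nonneg _) (fun n => ?_) (hf.add hg)
    simpa using norm_add_le (coeff n f) (coeff n g)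
  algebraMap_mem' c := by
    refine summable_of_ne_finset_zero (s := {0}) fun n hn => ?_
    rw [Finset.mem_singleton] at hn
    simp [coeff_C, hn]

namespace wienerAlgebra

theorem summable_coeff (f : wienerAlgebra) : Summable fun n => ‖coeff n f.1‖ := f.2

/-- The norm `∑ n, ‖coeff n f‖`. -/
noncomputable def ringNorm : RingNorm wienerAlgebra where
  toFun f := ∑' n, ‖coeff n f.1‖
  map_zero' := by simp
  add_le' f g := by
    rw [← (summable_coeff f).tsum_add (summable_coeff g)]
    exact (summable_coeff (f + g)).tsum_le_tsum (fun n => by simpa using norm_add_le _ _)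
      ((summable_coeff f).add (summable_coeff g))
  neg' f := by simp
  mul_le' f g := by
    rw [tsum_mul_tsum_eq_tsum_sum_antidiagonal_of_summable_norm
      (f := fun n => ‖coeff n f.1‖) (g := fun n => ‖coeff n g.1‖)
      (by simpa using summable_coeff f) (by simpa using summable_coeff g)]
    refine (summable_coeff (f * g)).tsum_le_tsum (fun n => ?_) ?_
    · simpa [coeff_mul] using norm_sum_le (Finset.HasAntidiagonal.antidiagonal n)
        fun p => coeff p.1 f.1 * coeff p.2 g.1
    · simpa using (summable_norm_sum_mul_antidiagonal_of_summable_norm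
        (f := fun n => ‖coeff n f.1‖) (g := fun n => ‖coeff n g.1‖)
        (by simpa using summable_coeff f) (by simpa using summable_coeff g)).of_norm
  eq_zero_of_map_eq_zero' f hf := by
    have h := (hasSum_zero_iff_of_nonneg fun n => norm_nonneg (coeff n f.1)).1
      (hf ▸ (summable_coeff f).hasSum)
    ext n
    simpa using congrFun h n

noncomputable instance : NormedCommRing wienerAlgebra where
  __ := wienerAlgebra.toCommRing
  __ := ringNorm.toAddGroupNorm.toNormedAddCommGroup
  norm_mul_le := ringNorm.mul_le'

theorem norm_def (f : wienerAlgebra) : ‖f‖ = ∑' n, ‖coeff n f.1‖ := rfl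

noncomputable instance : NormedAlgebra ℂ wienerAlgebra where
  __ := wienerAlgebra.algebra
  norm_smul_le c f := by simp [norm_def, tsum_mul_left]

/-- The coefficient sequence identifies the algebra, as a normed space, with `ℓ¹(ℕ)`. -/
noncomputable def equivLp : wienerAlgebra ≃ₗᵢ[ℂ] lp (fun _ : ℕ => ℂ) 1 where
  toFun f := ⟨fun n => coeff n f.1, memℓp_gen <| by simpa using summable_coeff f⟩
  invFun a := ⟨PowerSeries.mk a, by
    simpa [wienerAlgebra] using (memℓp_gen_iff (by simp)).1 (lp.memℓp a)⟩
  map_add' f g := by ext; simp; rfl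
  map_smul' c f := by ext; simp
  left_inv f := by ext; simp
  right_inv a := by ext; simp
  norm_map' f := by
    rw [lp.norm_eq_tsum_rpow (by simp)]
    simp [norm_def]

instance : CompleteSpace wienerAlgebra :=
  equivLp.toIsometryEquiv.completeSpace

theorem norm_coeff_le (f : wienerAlgebra) (n : ℕ) : ‖coeff n f.1‖ ≤ ‖f‖ :=
  (summable_coeff f).le_tsum n fun _ _ => norm_nonneg _

/-- The variable, as an element of the algebra. -/
noncomputable def X : wienerAlgebra :=
  ⟨PowerSeries.X, summable_of_ne_finset_zero (s := {1}) fun n hn => by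
    rw [Finset.mem_singleton] at hn
    simp [coeff_X, hn]⟩

@[simp]
theorem coe_X : (X : ℂ⟦X⟧) = PowerSeries.X := rfl

theorem norm_X_pow (n : ℕ) : ‖X ^ n‖ = 1 := by
  rw [norm_def, tsum_eq_single n fun k hk => by simp [coeff_X_pow, hk]]
  simp [coeff_X_pow]

instance : NormOneClass wienerAlgebra := ⟨by simpa using norm_X_pow 0⟩

theorem hasSum_coeff_smul_X_pow (f : wienerAlgebra) :
    HasSum (fun n => coeff n f.1 • X ^ n) f := by
  have hs : Summable fun n => coeff n f.1 • X ^ n := by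
    refine Summable.of_norm ?_
    simpa [norm_smul, norm_X_pow] using summable_coeff f
  suffices h : ∑' n, coeff n f.1 • X ^ n = f by simpa only [h] using hs.hasSum
  ext m
  let ev : wienerAlgebra →ₗ[ℂ] ℂ := (coeff m).comp wienerAlgebra.val.toLinearMap
  have hev : HasSum (fun n => ev (coeff n f.1 • X ^ n)) (ev (∑' n, coeff n f.1 • X ^ n)) :=
    hs.hasSum.map (ev.mkContinuous 1 fun g => by simpa [ev] using norm_coeff_le g m)
      (ContinuousLinearMap.continuous _)
  have h := hev.unique (hasSum_single m fun k hk => by simp [ev, coeff_X_pow, hk.symm])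
  simpa [ev, coeff_X_pow] using h

theorem summable_eval (f : wienerAlgebra) {w : ℂ} (hw : ‖w‖ ≤ 1) :
    Summable fun n => ‖coeff n f.1 * w ^ n‖ :=
  (summable_coeff f).of_nonneg_of_le (fun _ => norm_nonneg _) fun n => by
    rw [norm_mul, norm_pow]
    exact mul_le_of_le_one_right (norm_nonneg _) (pow_le_one₀ (norm_nonneg _) hw)

/-- Evaluation at a point of the closed unit disc. -/
noncomputable def eval (w : ℂ) (hw : ‖w‖ ≤ 1) : wienerAlgebra →ₐ[ℂ] ℂ where
  toFun f := ∑' n, coeff n f.1 * w ^ n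
  map_one' := by
    rw [tsum_eq_single 0 fun n hn => by simp [coeff_one, hn]]
    simp
  map_mul' f g := tsum_coeff_mul (summable_eval f hw) (summable_eval g hw)
  map_zero' := by simp
  map_add' f g := by
    rw [← (summable_eval f hw).of_norm.tsum_add (summable_eval g hw).of_norm]
    simp [add_mul]
  commutes' c := by
    rw [tsum_eq_single 0 fun n hn => by simp [coeff_C, hn]]
    simp

theorem eval_apply (f : wienerAlgebra) {w : ℂ} (hw : ‖w‖ ≤ 1) :
    eval w hw f = ∑' n, coeff n f.1 * w ^ n := rfl

theorem hasSum_eval (f : wienerAlgebra) {w : ℂ} (hw : ‖w‖ ≤ 1) :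
    HasSum (fun n => coeff n f.1 * w ^ n) (eval w hw f) :=
  (summable_eval f hw).of_norm.hasSum

@[simp]
theorem eval_X {w : ℂ} (hw : ‖w‖ ≤ 1) : eval w hw X = w := by
  rw [eval_apply, tsum_eq_single 1 fun n hn => by simp [coeff_X, hn]]
  simp

/-- The partial sums of the coefficients converge to the value at `1`. -/
theorem tendsto_sum_coeff (f : wienerAlgebra) :
    Tendsto (fun n => ∑ k ∈ Finset.range n, coeff k f.1) atTop (𝓝 (eval 1 (by simp) f)) := by
  simpa using (hasSum_eval f (w := 1) (by simp)).tendsto_sum_nat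

theorem norm_sum_coeff_le (f : wienerAlgebra) (s : Finset ℕ) : ‖∑ k ∈ s, coeff k f.1‖ ≤ ‖f‖ :=
  (norm_sum_le _ _).trans ((summable_coeff f).sum_le_tsum s fun _ _ => norm_nonneg _)

/-- **Wiener's lemma** on the closed disc: an absolutely convergent power series without zeros in
the closed unit disc is invertible in the algebra of such series. The characters of the algebra are
determined by the image of `X`, hence are evaluations at points of the disc. -/
theorem isUnit_of_eval_ne_zero (f : wienerAlgebra)
    (hf : ∀ (w : ℂ) (hw : ‖w‖ ≤ 1), eval w hw f ≠ 0) : IsUnit f := by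
  by_contra h
  obtain ⟨φ, hφ⟩ := WeakDual.CharacterSpace.exists_apply_eq_zero h
  have hw : ‖φ X‖ ≤ 1 := by
    simpa using (AlgHom.norm_apply_le_self φ X).trans_eq (by simpa using norm_X_pow 1)
  refine hf _ hw ?_
  have h1 := (hasSum_coeff_smul_X_pow f).map φ (map_continuous φ)
  rw [hφ] at h1
  refine (hasSum_eval f hw).unique ?_
  convert h1 using 2 with n
  simp

end wienerAlgebra

/-! ### The series of `(1 - w) ^ α` on the closed unit disc -/

theorem one_sub_mem_slitPlane {w : ℂ} (hw : ‖w‖ ≤ 1) (h1 : w ≠ 1) : 1 - w ∈ Complex.slitPlane := by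
  refine Or.inl ?_
  by_contra! h
  have h2 : w.re ^ 2 + w.im ^ 2 ≤ 1 := by
    have := Complex.sq_norm w
    rw [Complex.normSq_apply] at this
    nlinarith [norm_nonneg w]
  simp only [Complex.sub_re, Complex.one_re] at h
  exact h1 (Complex.ext (by simp; nlinarith [sq_nonneg w.im]) (by simp; nlinarith [sq_nonneg w.im]))

theorem hasSum_phi {w : ℂ} (hw : ‖w‖ < 1) (β : ℂ) :
    HasSum (fun n => phi β n * w ^ n) ((1 - w) ^ (-β)) := by
  have h := (Complex.one_div_one_sub_cpow_hasFPowerSeriesOnBall_zero β).hasSum (y := w)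
    (by rw [← ENNReal.ofReal_one, Metric.eball_ofReal]; simpa using hw)
  simpa [Complex.cpow_neg, phi, add_comm, mul_comm] using h

theorem summable_norm_phi_mul_pow {w : ℂ} (hw : ‖w‖ < 1) (β : ℂ) :
    Summable fun n => ‖phi β n * w ^ n‖ := (hasSum_phi hw β).summable.norm

/-- The coefficients of `(1 - X) ^ α` are absolutely summable for `0 < re α`. As in Raabe's test,
their moduli `r n` satisfy `(re α / 2) * r n ≤ n * r n - (n + 1) * r (n + 1)` for large `n`, and the
right-hand side telescopes. -/
theorem summable_norm_phi_neg {α : ℂ} (hα : 0 < α.re) : Summable fun n => ‖phi (-α) n‖ := by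
  obtain ⟨N, hN⟩ := exists_nat_ge ((α.re ^ 2 + α.im ^ 2) / α.re + α.re)
  have key (n : ℕ) (hn : N ≤ n) :
      α.re / 2 * ‖phi (-α) n‖ ≤ n * ‖phi (-α) n‖ - (n + 1 : ℕ) * ‖phi (-α) (n + 1)‖ := by
    have hn' : (α.re ^ 2 + α.im ^ 2) / α.re + α.re ≤ n := hN.trans (by exact_mod_cast hn)
    have h1 : (n + 1 : ℕ) * ‖phi (-α) (n + 1)‖ = ‖-α + n‖ * ‖phi (-α) n‖ := by
      rw [← norm_mul, ← phi_succ, norm_mul]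
      norm_cast
    have h2 : ‖-α + n‖ ≤ n - α.re / 2 := by
      have h3 : α.re ≤ n := le_trans (by simp; positivity) hn'
      have h4 : (α.re ^ 2 + α.im ^ 2) ≤ n * α.re := by
        rw [← div_le_iff₀ hα]; linarith
      refine abs_le_of_sq_le_sq' ?_ (by linarith) |>.2
      rw [Complex.sq_norm, Complex.normSq_apply]
      simp
      nlinarith
    rw [h1]
    nlinarith [norm_nonneg (phi (-α) n)]
  rw [← summable_nat_add_iff N]
  refine summable_of_sum_range_le (c := 2 / α.re * (N * ‖phi (-α) N‖)) (fun _ => norm_nonneg _)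
    fun m => ?_
  have h : ∀ m : ℕ, α.re / 2 * ∑ k ∈ Finset.range m, ‖phi (-α) (k + N)‖ ≤
      N * ‖phi (-α) N‖ - (m + N : ℕ) * ‖phi (-α) (m + N)‖ := by
    intro m
    induction m with
    | zero => simp
    | succ m ih =>
      have := key (m + N) (by lia)
      rw [Finset.sum_range_succ, mul_add, show m + 1 + N = m + N + 1 by ring]
      linarith
  have h' : α.re / 2 * ∑ k ∈ Finset.range m, ‖phi (-α) (k + N)‖ ≤ N * ‖phi (-α) N‖ :=
    (h m).trans (sub_le_self _ (by positivity))
  rw [div_mul_eq_mul_div, le_div_iff₀ hα]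
  linarith

/-- The power series `(1 - X) ^ α`, for `0 < re α`, as an element of the Wiener algebra. -/
noncomputable def oneSubCpow {α : ℂ} (hα : 0 < α.re) : wienerAlgebra :=
  ⟨phiSeries (-α), by simpa [wienerAlgebra] using summable_norm_phi_neg hα⟩

@[simp]
theorem coe_oneSubCpow {α : ℂ} (hα : 0 < α.re) : (oneSubCpow hα : ℂ⟦X⟧) = phiSeries (-α) := rfl

theorem continuousOn_one_sub_cpow {α : ℂ} (hα : 0 < α.re) :
    ContinuousOn (fun w : ℂ => (1 - w) ^ α) (Metric.closedBall 0 1) := by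
  intro w hw
  have hc : ContinuousAt (fun u : ℂ => u ^ α) (1 - w) := by
    rcases eq_or_ne w 1 with rfl | h1
    · -- The boundary point where the base vanishes; continuity there needs `0 < re α`.
      rw [sub_self]
      exact ContinuousAt.comp (f := fun u : ℂ => (u, α)) (g := fun p : ℂ × ℂ => p.1 ^ p.2)
        (Complex.continuousAt_cpow_zero_of_re_pos hα) (by fun_prop)
    · exact continuousAt_cpow_const (one_sub_mem_slitPlane (by simpa using hw) h1)
  exact (hc.comp (f := fun w : ℂ => 1 - w) (by fun_prop)).continuousWithinAt

theorem eval_oneSubCpow {α : ℂ} (hα : 0 < α.re) {w : ℂ} (hw : ‖w‖ ≤ 1) :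
    wienerAlgebra.eval w hw (oneSubCpow hα) = (1 - w) ^ α := by
  have hE : Set.EqOn (fun w : ℂ => ∑' n, phi (-α) n * w ^ n) (fun w => (1 - w) ^ α)
      (Metric.closedBall 0 1) := by
    refine Set.EqOn.of_subset_closure (s := Metric.ball 0 1) (fun w hw => ?_) ?_
      (continuousOn_one_sub_cpow hα) Metric.ball_subset_closedBall
      (by rw [closure_ball _ one_ne_zero])
    · simpa using (hasSum_phi (by simpa using hw) (-α)).tsum_eq
    · refine continuousOn_tsum (fun n => by fun_prop) (summable_norm_phi_neg hα) fun n w hw => ?_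
      rw [norm_mul, norm_pow]
      exact mul_le_of_le_one_right (norm_nonneg _)
        (pow_le_one₀ (norm_nonneg _) (by simpa using hw))
  simpa [wienerAlgebra.eval_apply] using hE (show w ∈ Metric.closedBall 0 1 by simpa using hw)

/-! ### Stability when there are no roots outside the open unit disc -/

/-- The characteristic matrix `(1 - X) ^ α - X (A - 1)` over the Wiener algebra. -/
noncomputable def charMatrix {α : ℂ} (hα : 0 < α.re) (A : Matrix (Fin d) (Fin d) ℂ) :
    Matrix (Fin d) (Fin d) wienerAlgebra :=
  oneSubCpow hα • 1 - wienerAlgebra.X • (A - 1).map (algebraMap ℂ wienerAlgebra)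

/-- The values of the characteristic matrix at `w = z⁻¹` are those of the matrix
`z (1 - z⁻¹) ^ α - (A - 1)`, up to the factor `w`. -/
theorem isUnit_det_charMatrix {α : ℂ} (hα : 0 < α.re) {A : Matrix (Fin d) (Fin d) ℂ}
    (hA : AllRootsInUnitDisc α A) : IsUnit (charMatrix hα A).det := by
  refine wienerAlgebra.isUnit_of_eval_ne_zero _ fun w hw => ?_
  have hmap : (wienerAlgebra.eval w hw).mapMatrix (charMatrix hα A) =
      (1 - w) ^ α • (1 : Matrix (Fin d) (Fin d) ℂ) - w • (A - 1) := by
    ext i j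
    rcases eq_or_ne i j with rfl | hij
    · simp [charMatrix, eval_oneSubCpow]
    · simp [charMatrix, hij]
  rw [AlgHom.map_det, hmap]
  rcases eq_or_ne w 0 with rfl | h0
  · simp
  · intro hdet
    have hfac : (1 - w) ^ α • (1 : Matrix (Fin d) (Fin d) ℂ) - w • (A - 1) =
        w • ((w⁻¹ * (1 - w⁻¹⁻¹) ^ α) • (1 : Matrix (Fin d) (Fin d) ℂ) - (A - 1)) := by
      rw [smul_sub w (_ • _), smul_smul, inv_inv, mul_inv_cancel_left₀ h0]
    rw [hfac, Matrix.det_smul] at hdet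
    have h := hA w⁻¹ (inv_ne_zero h0) ((mul_eq_zero.1 hdet).resolve_left (pow_ne_zero _ h0))
    rw [norm_inv] at h
    exact absurd h (not_lt.2 ((one_le_inv₀ (norm_pos_iff.2 h0)).2 hw))

/-- If the characteristic matrix is invertible, every solution is the sequence of partial sums of
an absolutely summable sequence, the coefficients of `Q⁻¹ (1 - X) ^ α x(0)`. -/
theorem IsConvSolution.eq_sum_coeff {α : ℂ} (hα : 0 < α.re) {A : Matrix (Fin d) (Fin d) ℂ}
    (hA : IsUnit (charMatrix hα A).det) {x : ℕ → Fin d → ℂ} (hx : IsConvSolution α A x)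
    (n : ℕ) (i : Fin d) :
    x n i = ∑ k ∈ Finset.range (n + 1), coeff k
      ((charMatrix hα A)⁻¹.mulVec (fun j => oneSubCpow hα * algebraMap ℂ _ (x 0 j)) i).1 := by
  let val := wienerAlgebra.val.toRingHom
  let g : Fin d → ℂ⟦X⟧ := fun i => phiSeries (-1) * genSeries x i
  let b : Fin d → wienerAlgebra := fun j => oneSubCpow hα * algebraMap ℂ _ (x 0 j)
  have hg : (val.mapMatrix (charMatrix hα A)).mulVec g = fun j => val (b j) := by
    ext1 i
    refine Eq.trans ?_ (hx.genSeries_eq i)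
    unfold charMatrix
    generalize A - 1 = B
    simp [val, g, Matrix.mulVec, dotProduct, sub_mul, Finset.sum_sub_distrib,
      Matrix.one_apply, Finset.mul_sum, mul_assoc, apply_ite]
  have hinv : val.mapMatrix (charMatrix hα A)⁻¹ * val.mapMatrix (charMatrix hα A) = 1 := by
    rw [← map_mul, Matrix.nonsing_inv_mul _ hA, map_one]
  have hgi : g i = val ((charMatrix hα A)⁻¹.mulVec b i) := by
    have h := congrArg ((val.mapMatrix (charMatrix hα A)⁻¹).mulVec) hg
    rw [Matrix.mulVec_mulVec, hinv, Matrix.one_mulVec] at h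
    rw [h]
    simp [Matrix.mulVec, dotProduct, map_sum]
  have h1 : phiSeries 1 * g i = genSeries x i := by
    rw [← mul_assoc, phiSeries_mul_neg, one_mul]
  rw [← coeff_genSeries x, ← h1, coeff_phiSeries_one_mul, hgi]
  rfl

/-- Solutions are bounded by the `ℓ¹`-norm of the sequence `y` whose partial sums they are, and their
limit is the value at `1` of the generating function of `y`, which has the factor `(1 - 1) ^ α = 0`.
-/
theorem isAsymptoticallyStable_of_isUnit_det {α : ℂ} (hα : 0 < α.re)
    {A : Matrix (Fin d) (Fin d) ℂ} (hA : IsUnit (charMatrix hα A).det) :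
    IsAsymptoticallyStable (IsConvSolution α A) 0 := by
  set R := (charMatrix hα A)⁻¹ with hR
  refine ⟨fun ε hε => ?_, 1, one_pos, fun x hx _ => tendsto_pi_nhds.2 fun i => ?_⟩
  · let K := ∑ i, ∑ j, ‖R i j‖ * ‖oneSubCpow hα‖
    have hK : 0 ≤ K := by positivity
    refine ⟨ε / (K + 1), by positivity, fun x hx h0 t _ => ?_⟩
    rw [sub_zero, lt_div_iff₀ (by positivity)] at h0
    rw [sub_zero]
    refine lt_of_le_of_lt ?_ (show K * ‖x 0‖ < ε by nlinarith [norm_nonneg (x 0)])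
    refine (pi_norm_le_iff_of_nonneg (by positivity)).2 fun i => ?_
    rw [hx.eq_sum_coeff hα hA]
    refine (wienerAlgebra.norm_sum_coeff_le _ _).trans ?_
    calc ‖R.mulVec (fun j => oneSubCpow hα * algebraMap ℂ _ (x 0 j)) i‖
        ≤ ∑ j, ‖R i j * (oneSubCpow hα * algebraMap ℂ _ (x 0 j))‖ := by
          rw [Matrix.mulVec, dotProduct]
          exact norm_sum_le _ _
      _ ≤ ∑ j, ‖R i j‖ * ‖oneSubCpow hα‖ * ‖x 0‖ := by
          refine Finset.sum_le_sum fun j _ => ?_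
          rw [mul_assoc]
          refine (norm_mul_le _ _).trans ?_
          gcongr
          refine (norm_mul_le _ _).trans ?_
          rw [norm_algebraMap']
          gcongr
          exact norm_le_pi_norm _ j
      _ = (∑ j, ‖R i j‖ * ‖oneSubCpow hα‖) * ‖x 0‖ := by rw [Finset.sum_mul]
      _ ≤ K * ‖x 0‖ := by
          gcongr
          exact Finset.single_le_sum (f := fun i => ∑ j, ‖R i j‖ * ‖oneSubCpow hα‖)
            (fun _ _ => by positivity) (Finset.mem_univ i)
  · have h := (wienerAlgebra.tendsto_sum_coeff
      (R.mulVec (fun j => oneSubCpow hα * algebraMap ℂ _ (x 0 j)) i)).comp (tendsto_add_atTop_nat 1)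
    have h0 : α ≠ 0 := fun h => by simp [h] at hα
    simp only [Function.comp_def, R, ← hx.eq_sum_coeff hα hA] at h
    convert! h using 2
    simp [Matrix.mulVec, dotProduct, eval_oneSubCpow, h0]

/-! ### Roots outside the open unit disc -/

/-- The solution of the convolution recursion with initial value `x₀`. -/
noncomputable def convSolution (α : ℂ) (A : Matrix (Fin d) (Fin d) ℂ) (x₀ : Fin d → ℂ) :
    ℕ → Fin d → ℂ
  | 0 => x₀
  | t + 1 => x₀ + (A - 1).mulVec
      (∑ s : Fin (t + 1), phi α (t - s) • convSolution α A x₀ s)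

theorem convSolution_zero (α : ℂ) (A : Matrix (Fin d) (Fin d) ℂ) (x₀ : Fin d → ℂ) :
    convSolution α A x₀ 0 = x₀ := by rw [convSolution]

theorem isConvSolution_convSolution (α : ℂ) (A : Matrix (Fin d) (Fin d) ℂ) (x₀ : Fin d → ℂ) :
    IsConvSolution α A (convSolution α A x₀) := by
  intro t
  rw [convSolution_zero, convSolution, conv,
    Fin.sum_univ_eq_sum_range (fun s => phi α (t - s) • convSolution α A x₀ s)]

/-- Pairing a solution with a left eigenvector `u` of `A - 1` gives a solution of the scalar
equation, here in terms of generating functions. -/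
theorem IsConvSolution.mk_dotProduct_eq {α c : ℂ} {A : Matrix (Fin d) (Fin d) ℂ}
    {u : Fin d → ℂ} (hu : Matrix.vecMul u (A - 1) = c • u) {x : ℕ → Fin d → ℂ}
    (hx : IsConvSolution α A x) :
    (phiSeries (-α) - C c * X) * PowerSeries.mk (fun n => u ⬝ᵥ x n) =
      phiSeries (1 - α) * C (u ⬝ᵥ x 0) := by
  have h1 : phiSeries 1 * phiSeries (-1) = 1 := phiSeries_mul_neg 1
  have hS : PowerSeries.mk (fun n => u ⬝ᵥ x n) = ∑ i, C (u i) * genSeries x i := by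
    ext n
    simp [dotProduct]
  have hsum := congrArg (phiSeries 1 * ·) (Finset.sum_congr (s₁ := Finset.univ) rfl fun i _ =>
    congrArg (C (u i) * ·) (hx.genSeries_eq i))
  have hB : ∑ i, C (u i) * ∑ j, C ((A - 1) i j) * (phiSeries (-1) * genSeries x j) =
      phiSeries (-1) * (C c * ∑ i, C (u i) * genSeries x i) := by
    simp only [Finset.mul_sum]
    rw [Finset.sum_comm]
    refine Finset.sum_congr rfl fun j _ => ?_
    have hj := congrArg C (congrFun hu j)
    simp only [Matrix.vecMul, dotProduct, Pi.smul_apply, smul_eq_mul, map_sum, map_mul] at hj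
    rw [← mul_assoc (C c), ← hj, Finset.sum_mul, Finset.mul_sum]
    exact Finset.sum_congr rfl fun i _ => by ring
  have hL : ∑ i, C (u i) * (phiSeries (-α) * (phiSeries (-1) * genSeries x i) -
      X * ∑ j, C ((A - 1) i j) * (phiSeries (-1) * genSeries x j)) =
      phiSeries (-1) * ((phiSeries (-α) - C c * X) * ∑ i, C (u i) * genSeries x i) := by
    have hsub (S : Fin d → ℂ⟦X⟧) :
        ∑ i, C (u i) * (phiSeries (-α) * (phiSeries (-1) * genSeries x i) - X * S i) =
          phiSeries (-α) * (phiSeries (-1) * ∑ i, C (u i) * genSeries x i) -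
            X * ∑ i, C (u i) * S i := by
      simp only [Finset.mul_sum, ← Finset.sum_sub_distrib]
      exact Finset.sum_congr rfl fun i _ => by ring
    rw [hsub, hB]
    ring
  have hR : ∑ i, C (u i) * (phiSeries (-α) * C (x 0 i)) = phiSeries (-α) * C (u ⬝ᵥ x 0) := by
    simp only [dotProduct, map_sum, map_mul, Finset.mul_sum]
    exact Finset.sum_congr rfl fun i _ => by ring
  rw [hL, hR, ← mul_assoc, h1, one_mul, ← mul_assoc, ← phiSeries_add, ← sub_eq_add_neg] at hsum
  rw [hS, hsum]

theorem summable_norm_mul_pow_of_tendsto {ξ : ℕ → ℂ} {a : ℂ} (hξ : Tendsto ξ atTop (𝓝 a)) {s : ℂ}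
    (hs : ‖s‖ < 1) : Summable fun n => ‖ξ n * s ^ n‖ := by
  obtain ⟨M, hM⟩ := hξ.norm.bddAbove_range
  refine ((summable_geometric_of_lt_one (norm_nonneg _) hs).mul_left M).of_nonneg_of_le
    (fun _ => norm_nonneg _) fun n => ?_
  rw [norm_mul, norm_pow]
  gcongr
  exact hM ⟨n, rfl⟩

/-- If the coefficients of `F` tend to zero, then `F(r w) = o(1 / (1 - r))` as `r → 1⁻`, for `w` in
the closed unit disc. This is Abel's limit theorem for the series `(1 - X) F(w X)`, whose partial
sums are the coefficients of `F(w X)`. -/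
theorem tendsto_one_sub_mul_tsum {ξ : ℕ → ℂ} (hξ : Tendsto ξ atTop (𝓝 0)) {w : ℂ} (hw : ‖w‖ ≤ 1) :
    Tendsto (fun r : ℝ => (1 - (r : ℂ)) * ∑' n, ξ n * ((r : ℂ) * w) ^ n) (𝓝[<] 1) (𝓝 0) := by
  let H : ℂ⟦X⟧ := PowerSeries.mk fun n => ξ n * w ^ n
  have hH : Tendsto (fun n => ξ n * w ^ n) atTop (𝓝 0) := by
    refine squeeze_zero_norm (fun n => ?_) (tendsto_zero_iff_norm_tendsto_zero.1 hξ)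
    rw [norm_mul, norm_pow]
    exact mul_le_of_le_one_right (norm_nonneg _) (pow_le_one₀ (norm_nonneg _) hw)
  have hs : Tendsto (fun n => ∑ k ∈ Finset.range n, coeff k (phiSeries (-1) * H)) atTop (𝓝 0) := by
    rw [← tendsto_add_atTop_iff_nat 1]
    simp_rw [← coeff_phiSeries_one_mul, ← mul_assoc, phiSeries_mul_neg, one_mul, H, coeff_mk]
    exact hH
  have hA := tendsto_map'_iff.1 (Complex.tendsto_tsum_powerSeries_nhdsWithin_lt hs)
  refine hA.congr' ?_
  filter_upwards [Ioo_mem_nhdsLT (zero_lt_one' ℝ)] with r hr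
  have hr1 : ‖(r : ℂ)‖ < 1 := by simpa [abs_of_pos hr.1] using hr.2
  have hsum : Summable fun n => ‖coeff n H * (r : ℂ) ^ n‖ := by
    simpa only [H, coeff_mk] using summable_norm_mul_pow_of_tendsto hH hr1
  rw [Function.comp_apply, tsum_coeff_mul (by simpa using summable_norm_phi_mul_pow hr1 (-1)) hsum]
  congr 1
  · simpa using (hasSum_phi hr1 (-1)).tsum_eq
  · exact tsum_congr fun n => by rw [coeff_mk, mul_pow]; ring

/-- A sequence tending to zero that solves the scalar equation with `c w = (1 - w) ^ α`, where `w` lies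
in the closed unit disc, has initial value `a = 0`. For `w ≠ 1`, the equation
`((1 - s) ^ α - c s) F(s) = (1 - s) ^ (α - 1) a` at `s = r w` has a left-hand side tending to `0`
as `r → 1⁻`, because the first factor is `O(1 - r)`. -/
theorem eq_zero_of_tendsto_zero {α c w : ℂ} (hα : 0 < α.re) (hw : ‖w‖ ≤ 1)
    (hc : c * w = (1 - w) ^ α) {ξ : ℕ → ℂ} (hξ : Tendsto ξ atTop (𝓝 0)) {a : ℂ}
    (h : (phiSeries (-α) - C c * X) * PowerSeries.mk ξ = phiSeries (1 - α) * C a) : a = 0 := by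
  rcases eq_or_ne w 1 with rfl | h1
  · -- Here `c = 0`, so the sequence is constant.
    have h0 : α ≠ 0 := fun h => by simp [h] at hα
    have hc0 : c = 0 := by simpa [h0] using hc
    rw [hc0, map_zero, zero_mul, sub_zero, sub_eq_neg_add, phiSeries_add, mul_assoc,
      phiSeries_mul_left_inj] at h
    refine tendsto_nhds_unique (tendsto_const_nhds.congr fun n => ?_) hξ
    simpa [phi_one] using (congrArg (coeff n) h).symm
  have hsl := one_sub_mem_slitPlane hw h1
  by_contra ha
  let q : ℂ → ℂ := fun s => (1 - s * w) ^ α - c * (s * w)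
  have hq : (fun r : ℝ => q r) =O[𝓝[<] 1] fun r : ℝ => 1 - (r : ℂ) := by
    have hd : DifferentiableAt ℂ q 1 := by
      refine .sub (.cpow_const (by fun_prop) ?_) (by fun_prop)
      simpa using hsl
    have hO := hd.isBigO_sub
    have hq1 : q 1 = 0 := by simp [q, hc]
    simp only [hq1, sub_zero] at hO
    have hr : Tendsto (fun r : ℝ => (r : ℂ)) (𝓝[<] 1) (𝓝 1) :=
      (Complex.continuous_ofReal.tendsto' 1 1 (by simp)).mono_left nhdsWithin_le_nhds
    exact (hO.comp_tendsto hr).trans (.of_bound 1 (.of_forall fun r => by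
      simp [norm_sub_rev]))
  have hlim0 : Tendsto (fun r : ℝ => q r * ∑' n, ξ n * ((r : ℂ) * w) ^ n) (𝓝[<] 1) (𝓝 0) :=
    (hq.mul (Asymptotics.isBigO_refl _ _)).trans_tendsto (tendsto_one_sub_mul_tsum hξ hw)
  have hlim1 : Tendsto (fun r : ℝ => (1 - (r : ℂ) * w) ^ (α - 1) * a) (𝓝[<] 1)
      (𝓝 ((1 - w) ^ (α - 1) * a)) := by
    have hcont : ContinuousAt (fun r : ℝ => (1 - (r : ℂ) * w) ^ (α - 1) * a) 1 := by
      refine .mul (.cpow (by fun_prop) (by fun_prop) ?_) (by fun_prop)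
      simpa using hsl
    simpa using hcont.tendsto.mono_left nhdsWithin_le_nhds
  have heq : (fun r : ℝ => q r * ∑' n, ξ n * ((r : ℂ) * w) ^ n) =ᶠ[𝓝[<] 1]
      fun r : ℝ => (1 - (r : ℂ) * w) ^ (α - 1) * a := by
    filter_upwards [Ioo_mem_nhdsLT (zero_lt_one' ℝ)] with r hr
    have hs : ‖(r : ℂ) * w‖ < 1 := by
      rw [norm_mul, Complex.norm_real, Real.norm_of_nonneg hr.1.le]
      exact (mul_le_of_le_one_right hr.1.le hw).trans_lt hr.2
    set s := (r : ℂ) * w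
    have hsum : Summable fun n => ‖coeff n (PowerSeries.mk ξ) * s ^ n‖ := by
      simpa only [coeff_mk] using summable_norm_mul_pow_of_tendsto hξ hs
    have hX : HasSum (fun n => coeff n (C c * X : ℂ⟦X⟧) * s ^ n) (c * s) := by
      convert hasSum_single 1 fun n hn => ?_ using 1
      · simp
      · simp [coeff_X, hn]
    have hQ : HasSum (fun n => coeff n (phiSeries (-α) - C c * X) * s ^ n) (q r) := by
      simpa [sub_mul, q] using (hasSum_phi hs (-α)).sub hX
    have hC : HasSum (fun n => coeff n (phiSeries (1 - α) * C a) * s ^ n)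
        ((1 - s) ^ (α - 1) * a) := by
      simpa [mul_right_comm] using (hasSum_phi hs (1 - α)).mul_right a
    rw [← hC.tsum_eq, ← h, tsum_coeff_mul hQ.summable.norm hsum, hQ.tsum_eq]
    simp
  have hz := tendsto_nhds_unique (hlim1.congr' heq.symm) hlim0
  rcases mul_eq_zero.1 hz with hz | hz
  · exact Complex.slitPlane_ne_zero hsl ((Complex.cpow_eq_zero_iff _ _).1 hz).1
  · exact ha hz

theorem allRootsInUnitDisc_of_isAsymptoticallyStable {α : ℂ} (hα : 0 < α.re)
    {A : Matrix (Fin d) (Fin d) ℂ} (hA : IsAsymptoticallyStable (IsConvSolution α A) 0) :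
    AllRootsInUnitDisc α A := by
  intro z hz hdet
  by_contra! hz1
  obtain ⟨u, hu0, hu⟩ := Matrix.exists_vecMul_eq_zero_iff.2 hdet
  rw [Matrix.vecMul_sub, Matrix.vecMul_smul, Matrix.vecMul_one, sub_eq_zero] at hu
  obtain ⟨δ, hδ, hlim⟩ := hA.2
  have hstar : u ⬝ᵥ star u ≠ 0 := fun h => hu0 (dotProduct_self_star_eq_zero.1 h)
  -- The solution starting at a small multiple of `star u` has nonzero pairing with `u` at time `0`.
  let t : ℝ := δ / (2 * (‖u‖ + 1))
  have ht : 0 < t := by positivity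
  let x₀ : Fin d → ℂ := (t : ℂ) • star u
  have hx₀ : ‖x₀‖ < δ := by
    rw [norm_smul, norm_star, Complex.norm_real, Real.norm_of_nonneg ht.le, div_mul_eq_mul_div,
      div_lt_iff₀ (by positivity)]
    nlinarith [norm_nonneg u]
  have hx := isConvSolution_convSolution α A x₀
  have hx0 := hlim _ hx (by simpa [convSolution_zero] using hx₀)
  have hξ : Tendsto (fun n => u ⬝ᵥ convSolution α A x₀ n) atTop (𝓝 0) := by
    have : Continuous fun v : Fin d → ℂ => u ⬝ᵥ v := by fun_prop
    simpa [Function.comp_def] using (this.tendsto 0).comp hx0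
  have hw : ‖z⁻¹‖ ≤ 1 := by
    rw [norm_inv]
    exact inv_le_one_of_one_le₀ hz1
  have h0 := eq_zero_of_tendsto_zero hα hw (by field_simp) hξ (hx.mk_dotProduct_eq hu.symm)
  rw [convSolution_zero, dotProduct_smul, smul_eq_mul] at h0
  exact (mul_ne_zero (by exact_mod_cast ht.ne') hstar) h0

theorem isAsymptoticallyStable_isConvSolution_iff {α : ℂ} (hα : 0 < α.re)
    (A : Matrix (Fin d) (Fin d) ℂ) :
    IsAsymptoticallyStable (IsConvSolution α A) 0 ↔ AllRootsInUnitDisc α A :=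
  ⟨allRootsInUnitDisc_of_isAsymptoticallyStable hα,
    fun h => isAsymptoticallyStable_of_isUnit_det hα (isUnit_det_charMatrix hα h)⟩

end ComplexOrder

theorem theorem1 (d : ℕ) (α : ℂ) (hα₀ : 0 < α.re) (hα₁ : α.re < 1)
    (A : Matrix (Fin d) (Fin d) ℂ) :
    (∀ x : ℕ → Fin d → ℂ,
      ComplexOrder.IsCaputoSolution α A x ↔ ComplexOrder.IsConvSolution α A x) ∧
    (ComplexOrder.IsAsymptoticallyStable (ComplexOrder.IsCaputoSolution α A) 0 ↔
      ComplexOrder.AllRootsInUnitDisc α A) ∧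
    (ComplexOrder.IsAsymptoticallyStable (ComplexOrder.IsConvSolution α A) 0 ↔
      ComplexOrder.AllRootsInUnitDisc α A) := by
  have h := ComplexOrder.isCaputoSolution_iff_isConvSolution hα₁ A
  have hSol : ComplexOrder.IsCaputoSolution α A = ComplexOrder.IsConvSolution α A :=
    funext fun x => propext (h x)
  rw [hSol]
  exact ⟨fun _ => Iff.rfl, ComplexOrder.isAsymptoticallyStable_isConvSolution_iff hα₀ A,
    ComplexOrder.isAsymptoticallyStable_isConvSolution_iff hα₀ A⟩
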